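/- Let $N,T\ge 1$, and let $U_1,\dots,U_T$ be unitaries on $(\mathbb{C}^2)^{\otimes N}$. On $(\mathbb{C}^2)^{\otimes N}\otimes\mathbb{C}^{T+1}$, where the second factor is a clock register with basis $|0\rangle,\dots,|T\rangle$, let $\mathcal D$ be the channel with Kraus operators $$\tfrac1{\sqrt2}\,|0\cdots0\rangle\langle a|\otimes|0\rangle\langle 0|\ \ (a\in\{0,1\}^N),\qquad \tfrac1{\sqrt2}\,\mathbb 1\otimes|T\rangle\langle T|,$$ $$\tfrac1{\sqrt2}\bigl(U_{t+1}\otimes|t+1\rangle\langle t|+U_{t+1}^\dagger\otimes|t\rangle\langle t+1|\bigr)\ \ (0\le t\le T-1),$$ and let $\mathcal C$ be the channel obtained by replacing each operator of the last family by the two operators $\tfrac1{\sqrt2}U_{t+1}\otimes|t+1\rangle\langle t|$ and $\tfrac1{\sqrt2}U_{t+1}^\dagger\otimes|t\rangle\langle t+1|$. Put $|\psi_t\rangle=U_t\cdots U_1|0\cdots0\rangle$ and $$\rho_\infty=\frac1{T+1}\sum_{t=0}^T|\psi_t\rangle\langle\psi_t|\otimes|t\rangle\langle t|.$$ Then, for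 $\mathcal K=\mathcal D$ and for $\mathcal K=\mathcal C$, $\rho_\infty$ is the unique stationary state of $\mathcal K$, and $\mathcal K^m(X)\to\mathcal K^\infty(X):=\operatorname{tr}(X)\,\rho_\infty$ as $m\to\infty$ for every operator $X$. Moreover, let $$\hat m_{\mathcal K}(\varepsilon)=\min\Bigl\{m>0:\ \sup_{\rho}\|\mathcal K^m(\rho)-\mathcal K^\infty(\rho)\|_1\le\varepsilon\Bigr\}$$ be the $\varepsilon$-convergence time, where the supremum is over all states $\rho$ and $\|\cdot\|_1$ is the trace norm. Then, for both channels, the minimum exists and $$\hat m_{\mathcal K}(\varepsilon)=O\bigl(NT^2\log T\,\log(1/\varepsilon)\bigr),$$ in the following uniform sense: for every $\varepsilon_0\in(0,1)$ there is a constant $K>0$, depending only on $\varepsilon_0$, such that $\hat m_{\mathcal K}(\varepsilon)\le K\,NT^2\log T\,\log(1/\varepsilon)$ for all $N\ge1$, all $T\ge2$, all unitaries $U_1,\dots,U_T$ and all $0<\varepsilon\le\varepsilon_0$. -/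

import Mathlib

open Filter Topology
open scoped Matrix Kronecker ComplexOrder

noncomputable section

namespace DQC

/-- Computational basis labels `a ∈ {0,1}^N` of a register of `N` qubits. -/
abbrev Bits (N : ℕ) : Type := Fin N → Fin 2

/-- Basis labels of the full space: `N` qubits and one clock qudit of dimension `T + 1`. -/
abbrev Idx (N T : ℕ) : Type := Bits N × Fin (T + 1)

/-- Operators on the full space, as complex matrices in the computational basis. -/
abbrev Op (N T : ℕ) : Type := Matrix (Idx N T) (Idx N T) ℂ

/-- A circuit of `T` gates on `N` qubits; `U t` is the gate applied between clock values
`t` and `t + 1`. -/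
abbrev Circuit (N T : ℕ) : Type := Fin T → Matrix.unitaryGroup (Bits N) ℂ

section General

variable {n : Type*} [Fintype n] [DecidableEq n]

/-- The completely positive map `ρ ↦ ∑ i, E i ρ (E i)†` with Kraus operators `E i`. -/
def krausMap {ι : Type*} [Fintype ι] (E : ι → Matrix n n ℂ) : Module.End ℂ (Matrix n n ℂ) where
  toFun ρ := ∑ i, E i * ρ * (E i)ᴴ
  map_add' ρ σ := by simp [Matrix.mul_add, Matrix.add_mul, Finset.sum_add_distrib]
  map_smul' c ρ := by simp [Finset.smul_sum]

/-- Density matrices (quantum states). -/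
def IsDensityMatrix (ρ : Matrix n n ℂ) : Prop :=
  ρ.PosSemidef ∧ ρ.trace = 1

/-- The trace norm (Schatten 1-norm): the sum of the singular values of `A`, that is, of the
square roots of the eigenvalues of `A† A`. -/
def traceNorm (A : Matrix n n ℂ) : ℝ :=
  ∑ i, √((Matrix.isHermitian_conjTranspose_mul_self A).eigenvalues i)

/-- `ρ` is a stationary state of `𝒦`, and the only one. -/
def IsUniqueStationaryState (𝒦 : Module.End ℂ (Matrix n n ℂ)) (ρ : Matrix n n ℂ) : Prop :=
  IsDensityMatrix ρ ∧ 𝒦 ρ = ρ ∧ ∀ σ, IsDensityMatrix σ → 𝒦 σ = σ → σ = ρ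

/-- `𝒦inf` is the limit `𝒦^∞` of the iterates `𝒦^m`. -/
def IsLimitMap (𝒦 𝒦inf : Module.End ℂ (Matrix n n ℂ)) : Prop :=
  ∀ X, Tendsto (fun m : ℕ => (𝒦 ^ m) X) atTop (𝓝 (𝒦inf X))

/-- The map `X ↦ tr(X) ρ`, which sends every state to `ρ`. -/
def replaceBy (ρ : Matrix n n ℂ) : Module.End ℂ (Matrix n n ℂ) :=
  (Matrix.traceLinearMap n ℂ ℂ).smulRight ρ

/-- `m` is the `ε`-convergence time of `𝒦` to its limit `𝒦inf`: the least integer `m > 0` such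
that the supremum over all states `ρ` of `‖𝒦^m(ρ) - 𝒦^∞(ρ)‖₁` is at most `ε`. -/
def IsConvergenceTime (𝒦 𝒦inf : Module.End ℂ (Matrix n n ℂ)) (ε : ℝ) (m : ℕ) : Prop :=
  IsLeast {k : ℕ | 0 < k ∧
    ∀ ρ, IsDensityMatrix ρ → traceNorm ((𝒦 ^ k) ρ - 𝒦inf ρ) ≤ ε} m

end General

/-- `|x⟩⟨y|` on the qubit register. -/
abbrev ketbra {N : ℕ} (x y : Bits N) : Matrix (Bits N) (Bits N) ℂ := Matrix.single x y 1

/-- `|s⟩⟨t|` on the clock register. -/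
abbrev clock {T : ℕ} (s t : Fin (T + 1)) : Matrix (Fin (T + 1)) (Fin (T + 1)) ℂ :=
  Matrix.single s t 1

/-- The reset operators `2^{-1/2} |0…0⟩⟨a| ⊗ |0⟩⟨0|`. -/
def krausInit {N T : ℕ} (a : Bits N) : Op N T :=
  ((1 / √2 : ℝ) : ℂ) • (ketbra 0 a ⊗ₖ clock 0 0)

/-- The operator `2^{-1/2} 1 ⊗ |T⟩⟨T|`. -/
def krausFin {N T : ℕ} : Op N T :=
  ((1 / √2 : ℝ) : ℂ) • ((1 : Matrix (Bits N) (Bits N) ℂ) ⊗ₖ clock (Fin.last T) (Fin.last T))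

/-- The forward operators `2^{-1/2} U_{t+1} ⊗ |t+1⟩⟨t|`. -/
def krausFw {N T : ℕ} (U : Circuit N T) (t : Fin T) : Op N T :=
  ((1 / √2 : ℝ) : ℂ) • ((U t : Matrix (Bits N) (Bits N) ℂ) ⊗ₖ clock t.succ t.castSucc)

/-- The backward operators `2^{-1/2} U_{t+1}† ⊗ |t⟩⟨t+1|`. -/
def krausBw {N T : ℕ} (U : Circuit N T) (t : Fin T) : Op N T :=
  ((1 / √2 : ℝ) : ℂ) • ((U t : Matrix (Bits N) (Bits N) ℂ)ᴴ ⊗ₖ clock t.castSucc t.succ)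

/-- The propagation operators
`2^{-1/2} (U_{t+1} ⊗ |t+1⟩⟨t| + U_{t+1}† ⊗ |t⟩⟨t+1|)`. -/
def krausProp {N T : ℕ} (U : Circuit N T) (t : Fin T) : Op N T :=
  ((1 / √2 : ℝ) : ℂ) •
    ((U t : Matrix (Bits N) (Bits N) ℂ) ⊗ₖ clock t.succ t.castSucc
      + (U t : Matrix (Bits N) (Bits N) ℂ)ᴴ ⊗ₖ clock t.castSucc t.succ)

/-- The channel `𝒟`, with Kraus operators `init` (one for each `a`), `fin`, and `prop` (one for
each `t`). -/
def channelD {N T : ℕ} (U : Circuit N T) : Module.End ℂ (Op N T) :=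
  krausMap (Sum.elim krausInit (Sum.elim (fun _ : Unit => krausFin) (krausProp U)))

/-- The classical-walk channel `𝒞`, with Kraus operators `init` (one for each `a`), `fin`, and
`fw`, `bw` (one each for each `t`). -/
def channelC {N T : ℕ} (U : Circuit N T) : Module.End ℂ (Op N T) :=
  krausMap (Sum.elim krausInit (Sum.elim (fun _ : Unit => krausFin)
    (Sum.elim (krausFw U) (krausBw U))))

/-- The circuit history states `ψ_t = U_t ⋯ U_1 |0…0⟩`, `0 ≤ t ≤ T`. -/
def historyState {N T : ℕ} (U : Circuit N T) (t : Fin (T + 1)) : Bits N → ℂ :=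
  Fin.induction (motive := fun _ => Bits N → ℂ) (Pi.single 0 1)
    (fun s ψ => (U s : Matrix (Bits N) (Bits N) ℂ) *ᵥ ψ) t

/-- `ρ_∞ = (T+1)⁻¹ ∑_t |ψ_t⟩⟨ψ_t| ⊗ |t⟩⟨t|`. -/
def rhoInf {N T : ℕ} (U : Circuit N T) : Op N T :=
  (1 / ((T : ℂ) + 1)) •
    ∑ t : Fin (T + 1), Matrix.vecMulVec (historyState U t) (star (historyState U t)) ⊗ₖ clock t t

end DQC

end

/-! The block-diagonal unitary W = ∑ₜ Uₜ⋯U₁ ⊗ |t⟩⟨t| intertwines the Kraus operators of a circuit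
with those of the trivial circuit, all gates 1 (`channelD_gauge_conj`, `channelC_gauge_conj`), and
carries the history state of the trivial circuit to `rhoInf U`. So only the trivial circuit has to
be analysed, uniformly in U.

There the evolution can be read off entry by entry (`IsClockWalk`). Clock-off-diagonal entries at
least halve in size at each step. A clock-diagonal entry (a,b) ≠ (0,0) follows a simple walk on
{0,…,T} that is reflected at T and killed below 0, because the reset feeds nothing back into it; a
parabolic superharmonic weight makes it decay at rate 1 - 1/((T+1)(T+2)). The partial trace over the
qubits follows the walk reflected at both ends, whose neighbour differences obey the killed walk, so
it flattens to tr/(T+1). The (0,0) entry is the partial trace minus the other diagonal entries,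
hence converges too (`IsClockWalk.norm_sub_le`).

Entrywise bounds give a trace-norm bound with prefactor 3·8^N (T+2)^5. Its logarithm, O(N + log T),
times the relaxation time O(T²) gives the convergence time. Convergence to tr(X) ρ_∞ also forces
stationarity and uniqueness. -/

namespace DQC

/-! ### Simple random walks on {0,…,T}: killed and reflected -/

/-- The discrete parabola `(T+1)(T+2) - (T-t)(T-t+1)`, a positive superharmonic weight for the
walk on `{0, …, T}` killed below `0` and reflected at `T`. -/
noncomputable def walkWeight (T : ℕ) (t : ℝ) : ℝ := (T + 1) * (T + 2) - (T - t) * (T - t + 1)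

/-- The contraction rate of the killed walk with respect to `walkWeight`. -/
noncomputable def walkRate (T : ℕ) : ℝ := 1 - 1 / ((T + 1) * (T + 2))

/-- Lets entries that halve at every step be bounded with the same rate as the walk. -/
lemma walkRate_ge_half (T : ℕ) : 1 / 2 ≤ walkRate T := by
  have h : (1 : ℝ) / ((T + 1) * (T + 2)) ≤ 1 / 2 := by
    apply one_div_le_one_div_of_le (by norm_num)
    have : (0 : ℝ) ≤ T := Nat.cast_nonneg T
    nlinarith
  unfold walkRate
  linarith

lemma walkRate_nonneg (T : ℕ) : 0 ≤ walkRate T := by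
  linarith [walkRate_ge_half T]

lemma walkRate_lt_one (T : ℕ) : walkRate T < 1 := by
  have : (0 : ℝ) < 1 / ((T + 1) * (T + 2)) := by positivity
  unfold walkRate
  linarith

lemma one_le_walkWeight {T t : ℕ} (h : t ≤ T) : 1 ≤ walkWeight T t := by
  have h1 : (t : ℝ) ≤ T := by exact_mod_cast h
  have h2 : (0 : ℝ) ≤ t := Nat.cast_nonneg t
  unfold walkWeight
  nlinarith

lemma walkWeight_le {T t : ℕ} (h : t ≤ T) : walkWeight T t ≤ (T + 1) * (T + 2) := by
  have h1 : (t : ℝ) ≤ T := by exact_mod_cast h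
  have : 0 ≤ ((T : ℝ) - t) * (T - t + 1) := mul_nonneg (by linarith) (by linarith)
  unfold walkWeight
  linarith

/-- Since (T+1)(T+2) bounds the weight, losing 1 means losing at least the fraction 1/((T+1)(T+2))
of it. -/
lemma walkWeight_sub_one_le {T t : ℕ} (h : t ≤ T) :
    walkWeight T t - 1 ≤ walkRate T * walkWeight T t := by
  have hA : (0 : ℝ) < (T + 1) * (T + 2) := by positivity
  have : walkWeight T t / ((T + 1) * (T + 2)) ≤ 1 := (div_le_one hA).2 (walkWeight_le h)
  have e : walkRate T * walkWeight T t
      = walkWeight T t - walkWeight T t / ((T + 1) * (T + 2)) := by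
    unfold walkRate
    ring
  rw [e]
  linarith

/-- The parabola has constant second difference -2. -/
lemma walkWeight_average (T : ℕ) (t : ℝ) :
    (walkWeight T (t - 1) + walkWeight T (t + 1)) / 2 = walkWeight T t - 1 := by
  unfold walkWeight
  ring

/-- Exponential decay of subsolutions of the walk killed below `0` and reflected at `T`. -/
lemma killed_walk_decay {T : ℕ} {M : ℝ} (hM : 0 ≤ M) (g : ℕ → ℕ → ℝ)
    (h0 : ∀ t ≤ T, g 0 t ≤ M)
    (htop : ∀ m, g m (T + 1) ≤ g m T)
    (hstep : ∀ m, ∀ t ≤ T,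
      g (m + 1) t ≤ ((if t = 0 then 0 else g m (t - 1)) + g m (t + 1)) / 2)
    (m : ℕ) : ∀ t ≤ T, g m t ≤ M * walkRate T ^ m * walkWeight T t := by
  induction m with
  | zero =>
    intro t ht
    have := mul_le_mul_of_nonneg_left (one_le_walkWeight ht) hM
    have := h0 t ht
    simp only [pow_zero, mul_one]
    linarith
  | succ m ih =>
    intro t ht
    have hc : 0 ≤ M * walkRate T ^ m := mul_nonneg hM (pow_nonneg (walkRate_nonneg T) m)
    -- The weight vanishes at -1, which matches killing below 0.
    have hL : (if t = 0 then 0 else g m (t - 1))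
        ≤ M * walkRate T ^ m * walkWeight T ((t : ℝ) - 1) := by
      split_ifs with h
      · subst h
        apply mul_nonneg hc
        unfold walkWeight
        push_cast
        nlinarith
      · have := ih (t - 1) (by omega)
        rwa [Nat.cast_pred (Nat.pos_of_ne_zero h)] at this
    -- The weight takes equal values at T and T+1, which matches reflection at T.
    have hR : g m (t + 1) ≤ M * walkRate T ^ m * walkWeight T ((t : ℝ) + 1) := by
      rcases ht.lt_or_eq with h | h
      · simpa using ih (t + 1) h
      · subst h
        refine ((htop m).trans (ih t le_rfl)).trans (le_of_eq ?_)
        unfold walkWeight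
        ring
    calc g (m + 1) t ≤ _ := hstep m t ht
      _ ≤ M * walkRate T ^ m *
          ((walkWeight T ((t : ℝ) - 1) + walkWeight T ((t : ℝ) + 1)) / 2) := by linarith
      _ = M * walkRate T ^ m * (walkWeight T t - 1) := by rw [walkWeight_average]
      _ ≤ M * walkRate T ^ m * (walkRate T * walkWeight T t) :=
          mul_le_mul_of_nonneg_left (walkWeight_sub_one_le ht) hc
      _ = _ := by ring

/-- The uniform form of `killed_walk_decay`. -/
lemma killed_walk_decay_uniform {T : ℕ} {M : ℝ} (hM : 0 ≤ M) (g : ℕ → ℕ → ℝ)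
    (h0 : ∀ t ≤ T, g 0 t ≤ M)
    (htop : ∀ m, g m (T + 1) ≤ g m T)
    (hstep : ∀ m, ∀ t ≤ T,
      g (m + 1) t ≤ ((if t = 0 then 0 else g m (t - 1)) + g m (t + 1)) / 2)
    (m : ℕ) {t : ℕ} (ht : t ≤ T) :
    g m t ≤ M * ((T + 1) * (T + 2)) * walkRate T ^ m := by
  have hc : 0 ≤ M * walkRate T ^ m := mul_nonneg hM (pow_nonneg (walkRate_nonneg T) m)
  have := killed_walk_decay hM g h0 htop hstep m t ht
  have := mul_le_mul_of_nonneg_left (walkWeight_le ht) hc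
  linarith

/-- The walk on `{0, …, T}` reflected at both ends converges to the uniform distribution. -/
lemma reflected_walk_decay {T : ℕ} {M : ℝ} (hM : 0 ≤ M) (x : ℕ → ℕ → ℂ)
    (h0 : ∀ t, ‖x 0 t‖ ≤ M)
    (htop : ∀ m t, T ≤ t → x m t = x m T)
    (hstep : ∀ m, ∀ t ≤ T, x (m + 1) t = (x m (t - 1) + x m (t + 1)) / 2)
    (m : ℕ) {t : ℕ} (ht : t ≤ T) :
    ‖x m t - (∑ s ∈ Finset.range (T + 1), x 0 s) / (T + 1)‖
      ≤ T * (2 * M * ((T + 1) * (T + 2)) * walkRate T ^ m) := by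
  set B : ℝ := 2 * M * ((T + 1) * (T + 2)) * walkRate T ^ m with hB
  -- Truncated subtraction makes `x m (0 - 1)` equal to `x m 0`, which is the reflection at 0;
  -- together with `htop` at T it conserves the total mass.
  have hsum : ∀ m, ∑ s ∈ Finset.range (T + 1), x m s = ∑ s ∈ Finset.range (T + 1), x 0 s := by
    intro m
    induction m with
    | zero => rfl
    | succ m ih =>
      rw [← ih, Finset.sum_congr rfl fun s hs =>
        hstep m s (Nat.lt_succ_iff.1 (Finset.mem_range.1 hs)), ← Finset.sum_div,
        Finset.sum_add_distrib, Finset.sum_range_succ' (fun s => x m (s - 1)),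
        Finset.sum_range_succ (fun s => x m (s + 1)), htop m (T + 1) (by omega)]
      have e1 := Finset.sum_range_succ (x m) T
      have e2 := Finset.sum_range_succ' (x m) T
      simp only [Nat.add_sub_cancel, Nat.zero_sub]
      linear_combination (-1 / 2 : ℂ) * e1 - (1 / 2 : ℂ) * e2
  -- Reflection makes the differences across both ends vanish, so the neighbour differences form a
  -- subsolution of the killed walk.
  have hdiff : ∀ t ≤ T, ‖x m (t + 1) - x m t‖ ≤ B := by
    intro t ht
    refine killed_walk_decay_uniform (by positivity) (fun m t => ‖x m (t + 1) - x m t‖)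
      (fun t _ => (norm_sub_le _ _).trans (by linarith [h0 (t + 1), h0 t])) ?_ ?_ m ht
    · intro m
      simp [htop m (T + 1 + 1) (by omega), htop m (T + 1) (by omega)]
    · intro m t ht
      rcases ht.lt_or_eq with h | h
      · rw [hstep m t ht, hstep m (t + 1) h]
        have e : (x m (t + 1 - 1) + x m (t + 1 + 1)) / 2 - (x m (t - 1) + x m (t + 1)) / 2
            = ((x m t - x m (t - 1)) + (x m (t + 1 + 1) - x m (t + 1))) / 2 := by
          simp only [Nat.add_sub_cancel]
          ring
        rw [e, norm_div, Complex.norm_ofNat]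
        refine div_le_div_of_nonneg_right ((norm_add_le _ _).trans ?_) (by norm_num)
        gcongr
        split_ifs with h1
        · simp [h1]
        · rw [Nat.sub_add_cancel (Nat.pos_of_ne_zero h1)]
      · rw [h, htop (m + 1) (T + 1) (by omega), sub_self, norm_zero]
        split_ifs <;> positivity
  have hB0 : 0 ≤ B := (norm_nonneg _).trans (hdiff 0 (Nat.zero_le T))
  have hmono : ∀ k s, s + k ≤ T → ‖x m (s + k) - x m s‖ ≤ k * B := by
    intro k s
    induction k with
    | zero => simp
    | succ k ih =>
      intro h
      have e : x m (s + (k + 1)) - x m s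
          = (x m (s + k + 1) - x m (s + k)) + (x m (s + k) - x m s) := by
        rw [← add_assoc]
        ring
      rw [e]
      refine (norm_add_le _ _).trans ?_
      have := ih (by omega)
      have := hdiff (s + k) (by omega)
      push_cast
      linarith
  have hpair : ∀ s ≤ T, ‖x m t - x m s‖ ≤ T * B := by
    intro s hs
    rcases le_total s t with h | h
    · obtain ⟨k, rfl⟩ := Nat.exists_eq_add_of_le h
      exact (hmono k s ht).trans (by gcongr; omega)
    · obtain ⟨k, rfl⟩ := Nat.exists_eq_add_of_le h
      rw [norm_sub_rev]
      exact (hmono k t hs).trans (by gcongr; omega)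
  -- The deviation from the mean is the average of the pairwise deviations, each at most T neighbour
  -- steps.
  have hT : ((T : ℂ) + 1) ≠ 0 := by exact_mod_cast Nat.succ_ne_zero T
  have e : x m t - (∑ s ∈ Finset.range (T + 1), x 0 s) / (T + 1)
      = (∑ s ∈ Finset.range (T + 1), (x m t - x m s)) / (T + 1) := by
    rw [← hsum m, Finset.sum_sub_distrib, Finset.sum_const, Finset.card_range, nsmul_eq_mul]
    field_simp
    push_cast
    ring
  have hn : ‖((T : ℂ) + 1)‖ = T + 1 := by
    exact_mod_cast Complex.norm_natCast (T + 1)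
  rw [e, norm_div, hn, div_le_iff₀ (by positivity)]
  refine (norm_sum_le_of_le _ fun s hs =>
    hpair s (Nat.lt_succ_iff.1 (Finset.mem_range.1 hs))).trans ?_
  rw [Finset.sum_const, Finset.card_range, nsmul_eq_mul]
  push_cast
  linarith

end DQC

/-! ### Entrywise convergence of clock walks -/

namespace DQC

/-- The clock value `min t T`. -/
def clamp (T t : ℕ) : Fin (T + 1) := ⟨min t T, by omega⟩

lemma clamp_zero (T : ℕ) : clamp T 0 = 0 := by
  ext
  simp [clamp]

lemma clamp_of_le {T t : ℕ} (h : T ≤ t) : clamp T t = Fin.last T := by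
  ext
  simp [clamp, h]

lemma clamp_val {T : ℕ} (t : Fin (T + 1)) : clamp T t = t := by
  ext
  simp [clamp]
  omega

lemma sum_range_clamp {T : ℕ} (f : Fin (T + 1) → ℂ) :
    ∑ s ∈ Finset.range (T + 1), f (clamp T s) = ∑ t, f t := by
  rw [Finset.sum_range]
  simp_rw [clamp_val]

lemma sum_succ_eq_clamp {T t : ℕ} (ht : t ≤ T) (f : Fin (T + 1) → ℂ) :
    (∑ r : Fin T, if clamp T t = r.succ then f r.castSucc else 0)
      = if t = 0 then 0 else f (clamp T (t - 1)) := by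
  rcases t with _ | t
  · simp [clamp_zero, (Fin.succ_ne_zero _).symm]
  · obtain ⟨r, e, e'⟩ : ∃ r : Fin T, clamp T (t + 1) = r.succ ∧ clamp T t = r.castSucc :=
      ⟨⟨t, ht⟩, by ext; simp [clamp, ht], by ext; simp [clamp]; omega⟩
    simp [e, e', Fin.succ_inj]

/-- The operator `krausFin` replaces the missing hop back from T+1, so it and the backward hops
together read the clamped value at t+1: this is the reflection at T. -/
lemma sum_castSucc_eq_clamp {T t : ℕ} (ht : t ≤ T) (f : Fin (T + 1) → ℂ) :
    (if clamp T t = Fin.last T then f (Fin.last T) else 0)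
      + (∑ r : Fin T, if clamp T t = r.castSucc then f r.succ else 0) = f (clamp T (t + 1)) := by
  rcases ht.lt_or_eq with h | h
  · obtain ⟨r, e, e'⟩ : ∃ r : Fin T, clamp T (t + 1) = r.succ ∧ clamp T t = r.castSucc :=
      ⟨⟨t, h⟩, by ext; simp [clamp]; omega, by ext; simp [clamp]; omega⟩
    simp [e, e', (Fin.castSucc_lt_last _).ne]
  · rw [clamp_of_le (t := t) h.ge, clamp_of_le (t := t + 1) (by omega)]
    simp [(Fin.castSucc_lt_last _).ne']

/-- Maps acting on the clock like the channels of the trivial circuit: the diagonal clock blocks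
perform a random walk with reset of the qubits at `0`, the off-diagonal blocks decay. -/
structure IsClockWalk {N T : ℕ} (F : Module.End ℂ (Op N T)) : Prop where
  diag : ∀ Y a b, ∀ t ≤ T, F Y (a, clamp T t) (b, clamp T t) =
    ((if t = 0 then (if a = 0 ∧ b = 0 then ∑ c, Y (c, 0) (c, 0) else 0)
      else Y (a, clamp T (t - 1)) (b, clamp T (t - 1)))
      + Y (a, clamp T (t + 1)) (b, clamp T (t + 1))) / 2
  offDiag : ∀ Y a b s t, s ≠ t → ‖F Y (a, s) (b, t)‖ ≤ ‖Y (a, t) (b, s)‖ / 2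

namespace IsClockWalk

variable {N T : ℕ} {F : Module.End ℂ (Op N T)} {Y : Op N T} {M : ℝ}

/-- A step is bounded through the entry with the clock labels exchanged, so the induction runs over
all pairs s ≠ t at once. -/
lemma norm_offDiag_le (hF : IsClockWalk F) (hY : ∀ i j, ‖Y i j‖ ≤ M) (m : ℕ) (a b : Bits N) :
    ∀ {s t : Fin (T + 1)}, s ≠ t → ‖(F ^ m) Y (a, s) (b, t)‖ ≤ M * walkRate T ^ m := by
  have hM : 0 ≤ M := (norm_nonneg _).trans (hY (0, 0) (0, 0))
  induction m with
  | zero => intro s t _; simpa using hY _ _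
  | succ m ih =>
    intro s t h
    rw [pow_succ', Module.End.mul_apply]
    have h1 := hF.offDiag ((F ^ m) Y) a b s t h
    have h2 := ih h.symm
    have h3 := mul_le_mul_of_nonneg_left (walkRate_ge_half T)
      (mul_nonneg hM (pow_nonneg (walkRate_nonneg T) m))
    rw [pow_succ]
    linarith

/-- The reset writes only into the entry (0,0) of the qubits, so for every other (a,b) clock value 0
has no inflow from below. -/
lemma norm_diag_le (hF : IsClockWalk F) (hY : ∀ i j, ‖Y i j‖ ≤ M) (m : ℕ) {a b : Bits N}
    (hab : ¬(a = 0 ∧ b = 0)) (t : Fin (T + 1)) :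
    ‖(F ^ m) Y (a, t) (b, t)‖ ≤ M * ((T + 1) * (T + 2)) * walkRate T ^ m := by
  have hM : 0 ≤ M := (norm_nonneg _).trans (hY (0, 0) (0, 0))
  have := killed_walk_decay_uniform (T := T) hM
    (fun m t => ‖(F ^ m) Y (a, clamp T t) (b, clamp T t)‖) (fun t _ => by simpa using hY _ _)
    (fun m => by simp [clamp_of_le]) ?_ m (Nat.lt_succ_iff.1 t.2)
  · simpa [clamp_val] using this
  · intro m t ht
    simp only [pow_succ', Module.End.mul_apply]
    rw [hF.diag _ a b t ht, norm_div, Complex.norm_ofNat, if_neg hab]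
    refine div_le_div_of_nonneg_right ((norm_add_le _ _).trans ?_) (by norm_num)
    gcongr
    split_ifs <;> simp

/-- The reset preserves the trace of the block at clock 0. After summing over a, it therefore acts
as a reflection at 0. The sum has 2^N terms, whence the factor on M. -/
lemma norm_partialTrace_sub_le (hF : IsClockWalk F) (hY : ∀ i j, ‖Y i j‖ ≤ M) (m : ℕ)
    (t : Fin (T + 1)) :
    ‖∑ a, (F ^ m) Y (a, t) (a, t) - Y.trace / (T + 1)‖
      ≤ T * (2 * (2 ^ N * M) * ((T + 1) * (T + 2)) * walkRate T ^ m) := by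
  have hM : 0 ≤ M := (norm_nonneg _).trans (hY (0, 0) (0, 0))
  have := reflected_walk_decay (T := T) (M := 2 ^ N * M) (by positivity)
    (fun m t => ∑ a, (F ^ m) Y (a, clamp T t) (a, clamp T t)) ?_ ?_ ?_ m
    (Nat.lt_succ_iff.1 t.2)
  · simp only [clamp_val] at this
    rw [sum_range_clamp (fun t => ∑ a, (F ^ 0) Y (a, t) (a, t)), Finset.sum_comm,
      ← Fintype.sum_prod_type'] at this
    simpa [Matrix.trace] using this
  · intro t
    exact (norm_sum_le_of_le _ fun a _ => by simpa using hY _ _).trans (by simp)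
  · intro m t ht
    simp [clamp_of_le ht, clamp_of_le]
  · intro m t ht
    simp only [pow_succ', Module.End.mul_apply]
    rw [Finset.sum_congr rfl fun a _ => hF.diag _ a a t ht, ← Finset.sum_div,
      Finset.sum_add_distrib]
    congr 2
    rcases t with _ | t
    · simp [clamp_zero]
    · simp

/-- All matrix elements of the iterates converge exponentially fast. -/
lemma norm_sub_le (hF : IsClockWalk F) (hY : ∀ i j, ‖Y i j‖ ≤ M) (m : ℕ) (i j : Idx N T) :
    ‖(F ^ m) Y i j - (if i.1 = 0 ∧ j.1 = 0 ∧ i.2 = j.2 then Y.trace / (T + 1) else 0)‖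
      ≤ 3 * 2 ^ N * ((T + 1) ^ 2 * (T + 2)) * M * walkRate T ^ m := by
  have hM : 0 ≤ M := (norm_nonneg _).trans (hY (0, 0) (0, 0))
  obtain ⟨a, s⟩ := i
  obtain ⟨b, t⟩ := j
  have hr := pow_nonneg (walkRate_nonneg T) m
  have h2 : (1 : ℝ) ≤ 2 ^ N := one_le_pow₀ one_le_two
  have hT : (0 : ℝ) ≤ T := Nat.cast_nonneg T
  set R := M * walkRate T ^ m with hR
  have hR0 : 0 ≤ R := mul_nonneg hM hr
  set A : ℝ := (T + 1) * (T + 2) with hA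
  have hA1 : 1 ≤ A := by nlinarith
  have goal_eq : 3 * 2 ^ N * (((T : ℝ) + 1) ^ 2 * (T + 2)) * M * walkRate T ^ m
      = (T + 1) * (3 * (2 ^ N * (A * R))) := by
    rw [hA, hR]
    ring
  have hAR : A * R ≤ 2 ^ N * (A * R) := le_mul_of_one_le_left (by positivity) h2
  have hRA : R ≤ A * R := le_mul_of_one_le_left hR0 hA1
  have hbig : 3 * (2 ^ N * (A * R)) ≤ (T + 1) * (3 * (2 ^ N * (A * R))) :=
    le_mul_of_one_le_left (by positivity) (by linarith)
  have hpos : 0 ≤ 2 ^ N * (A * R) := by positivity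
  rw [goal_eq]
  by_cases hst : s = t
  · subst hst
    by_cases hab : a = 0 ∧ b = 0
    · obtain ⟨rfl, rfl⟩ := hab
      have htr := hF.norm_partialTrace_sub_le hY m s
      have hrest : ‖∑ a ∈ Finset.univ.erase (0 : Bits N), (F ^ m) Y (a, s) (a, s)‖
          ≤ 2 ^ N * (A * R) := by
        refine (norm_sum_le_of_le _ fun a ha => hF.norm_diag_le hY m
          (fun h => (Finset.ne_of_mem_erase ha) h.1) s).trans ?_
        rw [Finset.sum_const, nsmul_eq_mul]
        have hc : ((Finset.univ.erase (0 : Bits N)).card : ℝ) ≤ 2 ^ N := by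
          refine (Nat.cast_le.2 (Finset.card_le_univ _)).trans ?_
          simp
        calc _ ≤ 2 ^ N * (M * A * walkRate T ^ m) := by gcongr
          _ = _ := by rw [hR]; ring
      -- The (0,0) entry obeys no closed equation; it is recovered from the partial trace and the
      -- decaying entries.
      have e : (F ^ m) Y (0, s) (0, s) - Y.trace / (T + 1)
          = (∑ a, (F ^ m) Y (a, s) (a, s) - Y.trace / (T + 1))
            - ∑ a ∈ Finset.univ.erase (0 : Bits N), (F ^ m) Y (a, s) (a, s) := by
        rw [← Finset.add_sum_erase _ _ (Finset.mem_univ (0 : Bits N))]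
        ring
      simp only [and_self, if_true]
      rw [e]
      refine (_root_.norm_sub_le _ _).trans ((add_le_add htr hrest).trans ?_)
      have : T * (2 * (2 ^ N * M) * A * walkRate T ^ m) = T * (2 * (2 ^ N * (A * R))) := by
        rw [hR]
        ring
      rw [this]
      -- The two contributions add up to the factor 2T + 1 ≤ 3(T + 1).
      nlinarith
    · have := hF.norm_diag_le hY m hab s
      rw [if_neg (fun h => hab ⟨h.1, h.2.1⟩), sub_zero]
      have e : M * A * walkRate T ^ m = A * R := by
        rw [hR]
        ring
      rw [e] at this
      linarith
  · have := hF.norm_offDiag_le hY m a b hst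
    rw [if_neg (fun h => hst h.2.2), sub_zero]
    linarith

end IsClockWalk

/-! ### The channels of the trivial circuit are clock walks -/

section TrivialCircuit

variable {N T : ℕ}

lemma one_kronecker_clock_mul (i j : Fin (T + 1)) (Y : Op N T) (a : Bits N) (s : Fin (T + 1))
    (q : Idx N T) :
    (((1 : Matrix (Bits N) (Bits N) ℂ) ⊗ₖ clock i j) * Y) (a, s) q
      = if s = i then Y (a, j) q else 0 := by
  rw [Matrix.mul_apply, Fintype.sum_prod_type, Finset.sum_eq_single a]
  · rw [Finset.sum_eq_single j]
    · simp [Matrix.kroneckerMap_apply, Matrix.single_apply, eq_comm]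
    · intro c _ hc
      simp [Matrix.kroneckerMap_apply, hc.symm]
    · simp
  · intro c _ hc
    simp [Matrix.kroneckerMap_apply, hc.symm]
  · simp

lemma one_kronecker_clock_conj (i j k l : Fin (T + 1)) (Y : Op N T) (a b : Bits N)
    (s t : Fin (T + 1)) :
    (((1 : Matrix (Bits N) (Bits N) ℂ) ⊗ₖ clock i j) * Y *
      ((1 : Matrix (Bits N) (Bits N) ℂ) ⊗ₖ clock k l)ᴴ) (a, s) (b, t)
      = if s = i ∧ t = k then Y (a, j) (b, l) else 0 := by
  rw [Matrix.mul_assoc, one_kronecker_clock_mul]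
  -- Right multiplication by an adjoint is the adjoint of a left multiplication, so the row formula
  -- applies a second time.
  have : Y * ((1 : Matrix (Bits N) (Bits N) ℂ) ⊗ₖ clock k l)ᴴ
      = (((1 : Matrix (Bits N) (Bits N) ℂ) ⊗ₖ clock k l) * Yᴴ)ᴴ := by simp
  rw [this, Matrix.conjTranspose_apply, one_kronecker_clock_mul]
  split_ifs <;> simp_all

lemma ketbra_kronecker_clock_conj (c : Bits N) (Y : Op N T) (a b : Bits N)
    (s t : Fin (T + 1)) :
    ((ketbra 0 c ⊗ₖ clock 0 0 : Op N T) * Y * (ketbra 0 c ⊗ₖ clock 0 0 : Op N T)ᴴ) (a, s) (b, t)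
      = if (a = 0 ∧ b = 0) ∧ s = 0 ∧ t = 0 then Y (c, 0) (c, 0) else 0 := by
  rw [Matrix.single_kronecker_single, Matrix.conjTranspose_single, mul_one, star_one,
    Matrix.single_mul_mul_single, Matrix.single_apply]
  simp only [Prod.mk.injEq, one_mul, mul_one]
  congr 1
  simp only [eq_comm (a := (0 : Bits N)), eq_comm (a := (0 : Fin (T + 1)))]
  exact propext and_and_and_comm

lemma smul_inv_sqrt_two_conj {n : Type*} [Fintype n] (A Y : Matrix n n ℂ) :
    (((1 / √2 : ℝ) : ℂ) • A) * Y * (((1 / √2 : ℝ) : ℂ) • A)ᴴ = (1 / 2 : ℂ) • (A * Y * Aᴴ) := by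
  rw [Matrix.conjTranspose_smul, Matrix.smul_mul, Matrix.smul_mul, Matrix.mul_smul, smul_smul]
  congr 1
  rw [Complex.star_def, Complex.conj_ofReal, ← Complex.ofReal_mul]
  have : (1 / √2) * (1 / √2) = (1 / 2 : ℝ) := by
    rw [div_mul_div_comm, Real.mul_self_sqrt (by norm_num)]
    norm_num
  rw [this]
  norm_num

lemma channelC_one_apply (Y : Op N T) (a b : Bits N) (s t : Fin (T + 1)) :
    channelC (1 : Circuit N T) Y (a, s) (b, t) = 1 / 2 *
      ((if (a = 0 ∧ b = 0) ∧ s = 0 ∧ t = 0 then ∑ c, Y (c, 0) (c, 0) else 0)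
      + ((if s = Fin.last T ∧ t = Fin.last T then Y (a, Fin.last T) (b, Fin.last T) else 0)
      + ((∑ r : Fin T, if s = r.succ ∧ t = r.succ then Y (a, r.castSucc) (b, r.castSucc) else 0)
      + ∑ r : Fin T, if s = r.castSucc ∧ t = r.castSucc then Y (a, r.succ) (b, r.succ)
          else 0))) := by
  simp only [channelC, krausMap, LinearMap.coe_mk, AddHom.coe_mk, Fintype.sum_sum_type,
    Sum.elim_inl, Sum.elim_inr, krausInit, krausFin, krausFw, krausBw, smul_inv_sqrt_two_conj,
    Finset.univ_unique, Finset.sum_singleton, Pi.one_apply, OneMemClass.coe_one,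
    Matrix.conjTranspose_one, ← Finset.smul_sum, ← smul_add, Matrix.smul_apply, Matrix.add_apply,
    Matrix.sum_apply, one_kronecker_clock_conj, ketbra_kronecker_clock_conj, smul_eq_mul]
  congr 2
  split_ifs <;> simp

/-- Expanding the conjugation by a coherent hop gives the two classical hops and two cross terms. A
cross term sends the clock coherence |r⟩⟨r+1| to |r+1⟩⟨r| or conversely. -/
lemma channelD_one_apply (Y : Op N T) (a b : Bits N) (s t : Fin (T + 1)) :
    channelD (1 : Circuit N T) Y (a, s) (b, t) = channelC (1 : Circuit N T) Y (a, s) (b, t)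
      + 1 / 2 * ∑ r : Fin T, ((if s = r.succ ∧ t = r.castSucc then Y (a, t) (b, s) else 0)
        + if s = r.castSucc ∧ t = r.succ then Y (a, t) (b, s) else 0) := by
  rw [channelC_one_apply]
  simp only [channelD, krausMap, LinearMap.coe_mk, AddHom.coe_mk, Fintype.sum_sum_type,
    Sum.elim_inl, Sum.elim_inr, krausInit, krausFin, krausProp, smul_inv_sqrt_two_conj,
    Finset.univ_unique, Finset.sum_singleton, Pi.one_apply, OneMemClass.coe_one,
    Matrix.conjTranspose_one, ← Finset.smul_sum, ← smul_add, Matrix.smul_apply, Matrix.add_apply,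
    Matrix.sum_apply, one_kronecker_clock_conj, ketbra_kronecker_clock_conj, smul_eq_mul,
    Matrix.conjTranspose_add, Matrix.add_mul, Matrix.mul_add]
  have e1 : (∑ c, if (a = 0 ∧ b = 0) ∧ s = 0 ∧ t = 0 then Y (c, 0) (c, 0) else 0)
      = if (a = 0 ∧ b = 0) ∧ s = 0 ∧ t = 0 then ∑ c, Y (c, 0) (c, 0) else 0 := by
    split_ifs <;> simp
  rw [e1, ← mul_add]
  congr 1
  rw [add_assoc, add_assoc, add_assoc, ← Finset.sum_add_distrib, ← Finset.sum_add_distrib]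
  congr 2
  refine Finset.sum_congr rfl fun r _ => ?_
  have e2 : (if s = r.succ ∧ t = r.castSucc then Y (a, t) (b, s) else 0)
      = if s = r.succ ∧ t = r.castSucc then Y (a, r.castSucc) (b, r.succ) else 0 := by
    split_ifs with h
    · rw [h.1, h.2]
    · rfl
  have e3 : (if s = r.castSucc ∧ t = r.succ then Y (a, t) (b, s) else 0)
      = if s = r.castSucc ∧ t = r.succ then Y (a, r.succ) (b, r.castSucc) else 0 := by
    split_ifs with h
    · rw [h.1, h.2]
    · rfl
  rw [e2, e3]
  ring

lemma channelC_one_diag (Y : Op N T) (a b : Bits N) {t : ℕ} (ht : t ≤ T) :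
    channelC (1 : Circuit N T) Y (a, clamp T t) (b, clamp T t) =
    ((if t = 0 then (if a = 0 ∧ b = 0 then ∑ c, Y (c, 0) (c, 0) else 0)
      else Y (a, clamp T (t - 1)) (b, clamp T (t - 1)))
      + Y (a, clamp T (t + 1)) (b, clamp T (t + 1))) / 2 := by
  have h1 := sum_succ_eq_clamp ht (fun r => Y (a, r) (b, r))
  have h2 := sum_castSucc_eq_clamp ht (fun r => Y (a, r) (b, r))
  have h3 : clamp T t = 0 ↔ t = 0 := by
    simp only [clamp, Fin.ext_iff, Fin.val_zero]
    omega
  rw [channelC_one_apply]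
  simp only [and_self, h3]
  beta_reduce at h1 h2
  rw [h1, ← h2]
  by_cases h0 : t = 0
  · simp only [h0, and_true, if_true]
    ring
  · simp only [h0, and_false, if_false]
    ring

lemma channelC_one_offDiag (Y : Op N T) (a b : Bits N) {s t : Fin (T + 1)} (h : s ≠ t) :
    channelC (1 : Circuit N T) Y (a, s) (b, t) = 0 := by
  have h' : ∀ r, ¬(s = r ∧ t = r) := fun r hr => h (hr.1.trans hr.2.symm)
  rw [channelC_one_apply]
  simp [h']

lemma isClockWalk_channelC_one : IsClockWalk (channelC (1 : Circuit N T)) where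
  diag Y a b _ ht := channelC_one_diag Y a b ht
  offDiag Y a b s t h := by
    rw [channelC_one_offDiag Y a b h, norm_zero]
    positivity

lemma isClockWalk_channelD_one : IsClockWalk (channelD (1 : Circuit N T)) where
  diag Y a b t ht := by
    rw [channelD_one_apply, channelC_one_diag Y a b ht]
    have h1 : ∀ r : Fin T, ¬(clamp T t = r.succ ∧ clamp T t = r.castSucc) := fun r hr =>
      (Fin.castSucc_lt_succ (i := r)).ne (hr.2.symm.trans hr.1)
    have h2 : ∀ r : Fin T, ¬(clamp T t = r.castSucc ∧ clamp T t = r.succ) := fun r hr =>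
      h1 r hr.symm
    simp only [h1, h2, if_false, add_zero, Finset.sum_const_zero, mul_zero]
  offDiag Y a b s t h := by
    rw [channelD_one_apply, channelC_one_offDiag Y a b h, zero_add]
    -- At most one edge r, in one orientation, joins s and t, so at most one cross term survives.
    have key : (∑ r : Fin T, ((if s = r.succ ∧ t = r.castSucc then Y (a, t) (b, s) else 0)
        + if s = r.castSucc ∧ t = r.succ then Y (a, t) (b, s) else 0)) = Y (a, t) (b, s) ∨
        (∑ r : Fin T, ((if s = r.succ ∧ t = r.castSucc then Y (a, t) (b, s) else 0)
        + if s = r.castSucc ∧ t = r.succ then Y (a, t) (b, s) else 0)) = 0 := by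
      by_cases hr : ∃ r : Fin T, s = r.succ ∧ t = r.castSucc ∨ s = r.castSucc ∧ t = r.succ
      · left
        obtain ⟨r, hr⟩ := hr
        rw [Finset.sum_eq_single r]
        · have : (r : ℕ) + 1 ≠ r := by omega
          rcases hr with ⟨rfl, rfl⟩ | ⟨rfl, rfl⟩ <;> simp [Fin.ext_iff]
        · intro q _ hq
          have hq' : (q : ℕ) ≠ r := fun h => hq (Fin.ext h)
          have : ¬(s = q.succ ∧ t = q.castSucc) ∧ ¬(s = q.castSucc ∧ t = q.succ) := by
            rcases hr with ⟨rfl, rfl⟩ | ⟨rfl, rfl⟩ <;>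
              simp only [Fin.ext_iff, Fin.val_succ, Fin.val_castSucc] <;> omega
          rw [if_neg this.1, if_neg this.2, add_zero]
        · simp
      · right
        refine Finset.sum_eq_zero fun r _ => ?_
        rw [if_neg fun h => hr ⟨r, .inl h⟩, if_neg fun h => hr ⟨r, .inr h⟩, add_zero]
    rcases key with h | h
    · rw [h, norm_mul]
      norm_num
      linarith
    · rw [h, mul_zero, norm_zero]
      positivity

end TrivialCircuit

end DQC

/-! ### States, limits, trace norm and intertwined Kraus maps -/

namespace DQC

section General

variable {n : Type*} [Fintype n]

/-- Write ρ as a sum of rank-one terms v v†. Then AM-GM bounds an entry by the mean of two diagonal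
entries, each at most the trace. -/
lemma IsDensityMatrix.norm_apply_le_one {ρ : Matrix n n ℂ} (hρ : IsDensityMatrix ρ) (i j : n) :
    ‖ρ i j‖ ≤ 1 := by
  obtain ⟨m, v, hv⟩ := Matrix.posSemidef_iff_eq_sum_vecMulVec.1 hρ.1
  have hentry : ∀ i j, ρ i j = ∑ k, v k i * star (v k j) := fun i j => by
    rw [hv, Matrix.sum_apply]
    rfl
  have hdiag : ∀ i, ρ i i = ((∑ k, ‖v k i‖ ^ 2 : ℝ) : ℂ) := fun i => by
    rw [hentry]
    push_cast
    exact Finset.sum_congr rfl fun k _ => Complex.mul_conj' _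
  have hle : ∀ i, ∑ k, ‖v k i‖ ^ 2 ≤ (1 : ℝ) := by
    intro i
    have htr : ∑ i, ∑ k, ‖v k i‖ ^ 2 = (1 : ℝ) := by
      have h := hρ.2
      rw [Matrix.trace] at h
      simp only [Matrix.diag_apply, hdiag] at h
      exact_mod_cast h
    rw [← htr]
    exact Finset.single_le_sum (f := fun i => ∑ k, ‖v k i‖ ^ 2)
      (fun i _ => Finset.sum_nonneg fun k _ => sq_nonneg _) (Finset.mem_univ i)
  calc ‖ρ i j‖ ≤ ∑ k, (‖v k i‖ ^ 2 + ‖v k j‖ ^ 2) / 2 := by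
        rw [hentry]
        refine norm_sum_le_of_le _ fun k _ => ?_
        rw [norm_mul, norm_star]
        nlinarith [sq_nonneg (‖v k i‖ - ‖v k j‖)]
    _ = (∑ k, ‖v k i‖ ^ 2 + ∑ k, ‖v k j‖ ^ 2) / 2 := by
        rw [← Finset.sum_div, Finset.sum_add_distrib]
    _ ≤ 1 := by linarith [hle i, hle j]

lemma trace_conjTranspose_mul_self_eq (A : Matrix n n ℂ) :
    (Aᴴ * A).trace = ((∑ i, ∑ j, ‖A j i‖ ^ 2 : ℝ) : ℂ) := by
  push_cast
  refine Finset.sum_congr rfl fun i _ => ?_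
  rw [Matrix.diag_apply, Matrix.mul_apply]
  exact Finset.sum_congr rfl fun j _ => Complex.conj_mul' _

lemma pow_conj {𝒦 F : Module.End ℂ (Matrix n n ℂ)} {W : Matrix n n ℂ}
    (h : ∀ Y, 𝒦 (W * Y * Wᴴ) = W * F Y * Wᴴ) (m : ℕ) (Y : Matrix n n ℂ) :
    (𝒦 ^ m) (W * Y * Wᴴ) = W * (F ^ m) Y * Wᴴ := by
  induction m with
  | zero => simp
  | succ m ih => rw [pow_succ', pow_succ', Module.End.mul_apply, Module.End.mul_apply, ih, h]

/-- The limit of the iterates of ρ is ρ, hence fixed by continuity; a stationary state is the limit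
of its own constant orbit, hence equal to ρ. -/
lemma IsLimitMap.isUniqueStationaryState {𝒦 : Module.End ℂ (Matrix n n ℂ)} {ρ : Matrix n n ℂ}
    (hρ : IsDensityMatrix ρ) (h : IsLimitMap 𝒦 (replaceBy ρ)) :
    IsUniqueStationaryState 𝒦 ρ := by
  have happ : ∀ σ, IsDensityMatrix σ → replaceBy ρ σ = ρ := fun σ hσ => by
    simp [replaceBy, hσ.2]
  refine ⟨hρ, ?_, fun σ hσ hfix => ?_⟩
  · have h1 := h ρ
    rw [happ ρ hρ] at h1
    have hcont : Continuous 𝒦 := LinearMap.continuous_of_finiteDimensional 𝒦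
    have h2 := (hcont.tendsto ρ).comp h1
    have h3 := h1.comp (tendsto_add_atTop_nat 1)
    refine tendsto_nhds_unique (h2.congr fun m => ?_) h3
    simp [pow_succ']
  · have h1 := h σ
    rw [happ σ hσ] at h1
    refine tendsto_nhds_unique (tendsto_const_nhds.congr fun m => ?_) h1
    induction m with
    | zero => simp
    | succ m ih => rw [pow_succ, Module.End.mul_apply, hfix, ← ih]

variable [DecidableEq n]

/-- Each singular value is at most the Hilbert–Schmidt norm. The loss against Cauchy–Schwarz is
harmless, since the dimension enters the final bound only through its logarithm. -/
lemma traceNorm_le_card_mul_sqrt_trace (A : Matrix n n ℂ) :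
    traceNorm A ≤ Fintype.card n * √((Aᴴ * A).trace.re) := by
  have hA := Matrix.isHermitian_conjTranspose_mul_self A
  have htr : (Aᴴ * A).trace.re = ∑ i, hA.eigenvalues i := by
    rw [hA.trace_eq_sum_eigenvalues]
    simp
  rw [traceNorm, htr]
  refine (Finset.sum_le_card_nsmul _ _ (√(∑ i, hA.eigenvalues i)) fun i _ => ?_).trans ?_
  · exact Real.sqrt_le_sqrt (Finset.single_le_sum
      (fun i _ => Matrix.eigenvalues_conjTranspose_mul_self_nonneg A i) (Finset.mem_univ i))
  · simp

/-- Passing through the Hilbert–Schmidt norm makes the unitary invariance a matter of cyclicity of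
the trace. -/
lemma traceNorm_unitary_conj_le {W : Matrix n n ℂ} (hW : Wᴴ * W = 1) {A : Matrix n n ℂ} {c : ℝ}
    (hc : 0 ≤ c) (hA : ∀ i j, ‖A i j‖ ≤ c) :
    traceNorm (W * A * Wᴴ) ≤ (Fintype.card n : ℝ) ^ 2 * c := by
  refine (traceNorm_le_card_mul_sqrt_trace _).trans ?_
  have e : ((W * A * Wᴴ)ᴴ * (W * A * Wᴴ)).trace = (Aᴴ * A).trace := by
    have : (W * A * Wᴴ)ᴴ * (W * A * Wᴴ) = W * (Aᴴ * (Wᴴ * W) * A * Wᴴ) := by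
      simp only [Matrix.conjTranspose_mul, Matrix.conjTranspose_conjTranspose, Matrix.mul_assoc]
    rw [this, Matrix.trace_mul_comm, Matrix.mul_assoc, hW, Matrix.mul_one,
      Matrix.mul_one]
  have h : √((Aᴴ * A).trace.re) ≤ Fintype.card n * c := by
    rw [trace_conjTranspose_mul_self_eq, Complex.ofReal_re]
    apply Real.sqrt_le_iff.2 ⟨by positivity, ?_⟩
    calc ∑ i, ∑ j, ‖A j i‖ ^ 2 ≤ ∑ _i : n, ∑ _j : n, c ^ 2 := by
          gcongr
          exact hA _ _
      _ = _ := by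
          simp only [Finset.sum_const, Finset.card_univ, nsmul_eq_mul]
          ring
  rw [e]
  calc _ ≤ (Fintype.card n : ℝ) * (Fintype.card n * c) := by gcongr
    _ = _ := by ring

lemma krausMap_conj {ι : Type*} [Fintype ι] {E E' : ι → Matrix n n ℂ} {W : Matrix n n ℂ}
    (h : ∀ i, E i * W = W * E' i) (Y : Matrix n n ℂ) :
    krausMap E (W * Y * Wᴴ) = W * krausMap E' Y * Wᴴ := by
  change ∑ i, E i * (W * Y * Wᴴ) * (E i)ᴴ = W * (∑ i, E' i * Y * (E' i)ᴴ) * Wᴴ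
  rw [Finset.mul_sum, Finset.sum_mul]
  refine Finset.sum_congr rfl fun i _ => ?_
  calc E i * (W * Y * Wᴴ) * (E i)ᴴ = (E i * W) * Y * (E i * W)ᴴ := by
        simp only [Matrix.conjTranspose_mul, Matrix.mul_assoc]
    _ = _ := by
        rw [h]
        simp only [Matrix.conjTranspose_mul, Matrix.mul_assoc]

end General

/-! ### The gauge unitary that removes the circuit -/

section Gauge

variable {N T : ℕ}

/-- The partial products `U_t ⋯ U_1` of a circuit. -/
def partialProduct (U : Circuit N T) (t : Fin (T + 1)) : Matrix.unitaryGroup (Bits N) ℂ :=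
  Fin.induction (motive := fun _ => Matrix.unitaryGroup (Bits N) ℂ) 1 (fun s V => U s * V) t

@[simp] lemma partialProduct_zero (U : Circuit N T) : partialProduct U 0 = 1 := rfl

lemma partialProduct_succ (U : Circuit N T) (t : Fin T) :
    partialProduct U t.succ = U t * partialProduct U t.castSucc :=
  Fin.induction_succ _ _ _

lemma historyState_eq (U : Circuit N T) (t : Fin (T + 1)) :
    historyState U t = (partialProduct U t : Matrix (Bits N) (Bits N) ℂ) *ᵥ Pi.single 0 1 := by
  induction t using Fin.induction with
  | zero => exact (Matrix.one_mulVec _).symm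
  | succ t ih =>
    rw [partialProduct_succ, Submonoid.coe_mul, ← Matrix.mulVec_mulVec, ← ih]
    exact Fin.induction_succ _ _ _

lemma historyState_one (t : Fin (T + 1)) : historyState (1 : Circuit N T) t = Pi.single 0 1 := by
  induction t using Fin.induction with
  | zero => rfl
  | succ t ih =>
    refine (Fin.induction_succ _ _ _).trans ?_
    change ((1 : Matrix.unitaryGroup (Bits N) ℂ) : Matrix (Bits N) (Bits N) ℂ) *ᵥ
      historyState (1 : Circuit N T) t.castSucc = _
    rw [ih]
    exact Matrix.one_mulVec _

/-- The unitary `∑ t, U_t ⋯ U_1 ⊗ |t⟩⟨t|`. -/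
def gauge (U : Circuit N T) : Op N T :=
  Matrix.blockDiagonal fun t => (partialProduct U t : Matrix (Bits N) (Bits N) ℂ)

lemma gauge_conjTranspose_mul_self (U : Circuit N T) : (gauge U)ᴴ * gauge U = 1 := by
  rw [gauge, Matrix.blockDiagonal_conjTranspose, ← Matrix.blockDiagonal_mul,
    ← Matrix.blockDiagonal_one]
  congr 1
  funext t
  exact Matrix.mem_unitaryGroup_iff'.1 (partialProduct U t).2

lemma gauge_mul_conjTranspose_self (U : Circuit N T) : gauge U * (gauge U)ᴴ = 1 :=
  mul_eq_one_comm.1 (gauge_conjTranspose_mul_self U)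

lemma kronecker_clock_mul_gauge (U : Circuit N T) (A : Matrix (Bits N) (Bits N) ℂ)
    (s t : Fin (T + 1)) :
    (A ⊗ₖ clock s t : Op N T) * gauge U
      = (A * (partialProduct U t : Matrix (Bits N) (Bits N) ℂ)) ⊗ₖ clock s t := by
  ext ⟨a, i⟩ ⟨b, j⟩
  rw [Matrix.mul_apply, Fintype.sum_prod_type_right, Finset.sum_eq_single t]
  · by_cases h : t = j <;> by_cases h' : s = i <;>
      simp [gauge, Matrix.blockDiagonal_apply, Matrix.kroneckerMap_apply, Matrix.mul_apply, h, h']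
  · intro c _ hc
    simp [Matrix.kroneckerMap_apply, hc.symm]
  · simp

lemma gauge_mul_kronecker_clock (U : Circuit N T) (A : Matrix (Bits N) (Bits N) ℂ)
    (s t : Fin (T + 1)) :
    gauge U * (A ⊗ₖ clock s t : Op N T)
      = ((partialProduct U s : Matrix (Bits N) (Bits N) ℂ) * A) ⊗ₖ clock s t := by
  ext ⟨a, i⟩ ⟨b, j⟩
  rw [Matrix.mul_apply, Fintype.sum_prod_type_right, Finset.sum_eq_single s]
  · by_cases h : t = j <;> by_cases h' : s = i <;>
      simp [gauge, Matrix.blockDiagonal_apply, Matrix.kroneckerMap_apply, Matrix.mul_apply, h, h',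
        eq_comm]
  · intro c _ hc
    simp [Matrix.kroneckerMap_apply, hc.symm]
  · simp

/-- The gauge is the identity on the block at clock 0. -/
lemma krausInit_mul_gauge (U : Circuit N T) (a : Bits N) :
    krausInit a * gauge U = gauge U * krausInit a := by
  rw [krausInit, Matrix.smul_mul, Matrix.mul_smul, kronecker_clock_mul_gauge,
    gauge_mul_kronecker_clock]
  simp

lemma krausFin_mul_gauge (U : Circuit N T) : krausFin * gauge U = gauge U * krausFin := by
  rw [krausFin, Matrix.smul_mul, Matrix.mul_smul, kronecker_clock_mul_gauge,
    gauge_mul_kronecker_clock, Matrix.one_mul, Matrix.mul_one]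

/-- The gate on the left is absorbed by the recursion for the partial products; in the backward case
it cancels against its adjoint. -/
lemma forward_mul_gauge (U : Circuit N T) (t : Fin T) :
    ((U t : Matrix (Bits N) (Bits N) ℂ) ⊗ₖ clock t.succ t.castSucc : Op N T) * gauge U
      = gauge U * ((1 : Matrix (Bits N) (Bits N) ℂ) ⊗ₖ clock t.succ t.castSucc : Op N T) := by
  rw [kronecker_clock_mul_gauge, gauge_mul_kronecker_clock, partialProduct_succ,
    Submonoid.coe_mul, Matrix.mul_one]

lemma backward_mul_gauge (U : Circuit N T) (t : Fin T) :
    ((U t : Matrix (Bits N) (Bits N) ℂ)ᴴ ⊗ₖ clock t.castSucc t.succ : Op N T) * gauge U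
      = gauge U * ((1 : Matrix (Bits N) (Bits N) ℂ) ⊗ₖ clock t.castSucc t.succ : Op N T) := by
  have h : (U t : Matrix (Bits N) (Bits N) ℂ)ᴴ * (U t : Matrix (Bits N) (Bits N) ℂ) = 1 :=
    Matrix.mem_unitaryGroup_iff'.1 (U t).2
  rw [kronecker_clock_mul_gauge, gauge_mul_kronecker_clock, partialProduct_succ,
    Submonoid.coe_mul, ← Matrix.mul_assoc, h, Matrix.mul_one, Matrix.one_mul]

lemma channelD_gauge_conj (U : Circuit N T) (Y : Op N T) :
    channelD U (gauge U * Y * (gauge U)ᴴ) = gauge U * channelD 1 Y * (gauge U)ᴴ := by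
  refine krausMap_conj (fun i => ?_) Y
  rcases i with a | _ | t
  · exact krausInit_mul_gauge U a
  · exact krausFin_mul_gauge U
  · simp only [Sum.elim_inr, krausProp, Matrix.smul_mul, Matrix.mul_smul, Matrix.add_mul,
      Matrix.mul_add, forward_mul_gauge, backward_mul_gauge, Pi.one_apply, OneMemClass.coe_one,
      Matrix.conjTranspose_one]

lemma channelC_gauge_conj (U : Circuit N T) (Y : Op N T) :
    channelC U (gauge U * Y * (gauge U)ᴴ) = gauge U * channelC 1 Y * (gauge U)ᴴ := by
  refine krausMap_conj (fun i => ?_) Y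
  rcases i with a | _ | t | t
  · exact krausInit_mul_gauge U a
  · exact krausFin_mul_gauge U
  · simp only [Sum.elim_inr, Sum.elim_inl, krausFw, Matrix.smul_mul, Matrix.mul_smul,
      forward_mul_gauge, Pi.one_apply, OneMemClass.coe_one]
  · simp only [Sum.elim_inr, krausBw, Matrix.smul_mul, Matrix.mul_smul,
      backward_mul_gauge, Pi.one_apply, OneMemClass.coe_one, Matrix.conjTranspose_one]

lemma rhoInf_eq_gauge_conj (U : Circuit N T) :
    rhoInf U = gauge U * rhoInf 1 * (gauge U)ᴴ := by
  rw [rhoInf, rhoInf, Matrix.mul_smul, Matrix.smul_mul, Finset.mul_sum, Finset.sum_mul]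
  congr 1
  refine Finset.sum_congr rfl fun t _ => ?_
  rw [historyState_one, gauge_mul_kronecker_clock, historyState_eq]
  have e : ∀ B : Matrix (Bits N) (Bits N) ℂ, (B ⊗ₖ clock t t : Op N T) * (gauge U)ᴴ
      = (B * (partialProduct U t : Matrix (Bits N) (Bits N) ℂ)ᴴ) ⊗ₖ clock t t := by
    intro B
    have := congrArg Matrix.conjTranspose (gauge_mul_kronecker_clock U Bᴴ t t)
    simpa [Matrix.conjTranspose_kronecker] using this
  rw [e, Matrix.mul_vecMulVec, Matrix.vecMulVec_mul, Matrix.star_mulVec]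

lemma rhoInf_one_apply (i j : Idx N T) : rhoInf (1 : Circuit N T) i j
    = if i.1 = 0 ∧ j.1 = 0 ∧ i.2 = j.2 then 1 / ((T : ℂ) + 1) else 0 := by
  obtain ⟨a, s⟩ := i
  obtain ⟨b, t⟩ := j
  rw [rhoInf, Matrix.smul_apply, Matrix.sum_apply, Finset.sum_eq_single s]
  · rw [historyState_one]
    by_cases h : s = t <;> by_cases ha : a = 0 <;> by_cases hb : b = 0 <;>
      simp [Matrix.vecMulVec_apply, h, ha, hb]
  · intro c _ hc
    simp [hc]
  · simp

lemma isDensityMatrix_rhoInf (U : Circuit N T) : IsDensityMatrix (rhoInf U) := by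
  constructor
  · refine Matrix.PosSemidef.smul (Matrix.posSemidef_sum _ fun t _ =>
      (Matrix.posSemidef_vecMulVec_self_star _).kronecker ?_) ?_
    · have : clock t t = Matrix.diagonal (Pi.single t (1 : ℂ)) :=
        (Matrix.diagonal_single t 1).symm
      rw [this]
      exact Matrix.PosSemidef.diagonal (Pi.single_nonneg.2 zero_le_one)
    · rw [show (1 : ℂ) / ((T : ℂ) + 1) = ((1 / ((T : ℝ) + 1) : ℝ) : ℂ) by push_cast; rfl]
      exact_mod_cast (by positivity : (0 : ℝ) ≤ 1 / ((T : ℝ) + 1))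
  · rw [rhoInf_eq_gauge_conj, Matrix.trace_mul_comm, ← Matrix.mul_assoc,
      gauge_conjTranspose_mul_self, Matrix.one_mul, Matrix.trace]
    have hT : ((T : ℂ) + 1) ≠ 0 := by exact_mod_cast Nat.succ_ne_zero T
    simp only [Matrix.diag_apply, rhoInf_one_apply, Fintype.sum_prod_type_right, and_true, and_self,
      Finset.sum_ite_eq', Finset.mem_univ, if_true, Finset.sum_const, Finset.card_univ,
      Fintype.card_fin, nsmul_eq_mul, Nat.cast_add, Nat.cast_one]
    exact mul_one_div_cancel hT

end Gauge

end DQC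

/-! ### From entrywise decay to the convergence time -/

namespace DQC

section Convergence

variable {N T : ℕ} {U : Circuit N T} {𝒦 F : Module.End ℂ (Op N T)}

lemma eq_gauge_conj (U : Circuit N T) (X : Op N T) :
    X = gauge U * ((gauge U)ᴴ * X * gauge U) * (gauge U)ᴴ := by
  calc X = (gauge U * (gauge U)ᴴ) * X * (gauge U * (gauge U)ᴴ) := by
        rw [gauge_mul_conjTranspose_self, Matrix.one_mul, Matrix.mul_one]
    _ = _ := by simp only [Matrix.mul_assoc]

lemma pow_sub_replaceBy_eq (h𝒦 : ∀ Y, 𝒦 (gauge U * Y * (gauge U)ᴴ) = gauge U * F Y * (gauge U)ᴴ)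
    (m : ℕ) (Y : Op N T) :
    (𝒦 ^ m) (gauge U * Y * (gauge U)ᴴ) - replaceBy (rhoInf U) (gauge U * Y * (gauge U)ᴴ)
      = gauge U * ((F ^ m) Y - Y.trace • rhoInf 1) * (gauge U)ᴴ := by
  have htr : (gauge U * Y * (gauge U)ᴴ).trace = Y.trace := by
    rw [Matrix.trace_mul_comm, ← Matrix.mul_assoc, gauge_conjTranspose_mul_self, Matrix.one_mul]
  rw [pow_conj h𝒦]
  simp only [replaceBy, LinearMap.smulRight_apply, Matrix.traceLinearMap_apply, htr]
  rw [rhoInf_eq_gauge_conj U]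
  simp only [Matrix.mul_sub, Matrix.sub_mul, Matrix.mul_smul, Matrix.smul_mul]

lemma IsClockWalk.norm_sub_smul_rhoInf_le (hF : IsClockWalk F) {Y : Op N T} {M : ℝ}
    (hY : ∀ i j, ‖Y i j‖ ≤ M) (m : ℕ) (i j : Idx N T) :
    ‖((F ^ m) Y - Y.trace • rhoInf 1 : Op N T) i j‖
      ≤ 3 * 2 ^ N * ((T + 1) ^ 2 * (T + 2)) * M * walkRate T ^ m := by
  have := hF.norm_sub_le hY m i j
  rw [Matrix.sub_apply, Matrix.smul_apply, rhoInf_one_apply, smul_eq_mul, mul_ite, mul_zero,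
    mul_one_div]
  exact this

lemma isLimitMap_of_isClockWalk (hF : IsClockWalk F)
    (h𝒦 : ∀ Y, 𝒦 (gauge U * Y * (gauge U)ᴴ) = gauge U * F Y * (gauge U)ᴴ) :
    IsLimitMap 𝒦 (replaceBy (rhoInf U)) := by
  intro X
  set Y := (gauge U)ᴴ * X * gauge U with hYdef
  obtain ⟨M, hM⟩ : ∃ M, ∀ i j, ‖Y i j‖ ≤ M := by
    refine ⟨∑ i, ∑ j, ‖Y i j‖, fun i j => ?_⟩
    exact (Finset.single_le_sum (f := fun j => ‖Y i j‖) (fun _ _ => norm_nonneg _)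
      (Finset.mem_univ j)).trans (Finset.single_le_sum (f := fun i => ∑ j, ‖Y i j‖)
        (fun _ _ => Finset.sum_nonneg fun _ _ => norm_nonneg _) (Finset.mem_univ i))
  have h0 : Tendsto (fun m => (F ^ m) Y - Y.trace • rhoInf 1) atTop (𝓝 0) := by
    refine tendsto_pi_nhds.2 fun i => tendsto_pi_nhds.2 fun j => ?_
    refine squeeze_zero_norm (fun m => hF.norm_sub_smul_rhoInf_le hM m i j) ?_
    simpa using (tendsto_pow_atTop_nhds_zero_of_lt_one (walkRate_nonneg T)
      (walkRate_lt_one T)).const_mul (3 * 2 ^ N * (((T : ℝ) + 1) ^ 2 * (T + 2)) * M)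
  have hcont : Continuous fun Z : Op N T => gauge U * Z * (gauge U)ᴴ := by fun_prop
  have h1 := (hcont.tendsto 0).comp h0
  rw [← tendsto_sub_nhds_zero_iff]
  simp only [Matrix.mul_zero, Matrix.zero_mul] at h1
  refine h1.congr fun m => ?_
  rw [Function.comp_apply, ← pow_sub_replaceBy_eq h𝒦, hYdef, ← eq_gauge_conj]

lemma IsDensityMatrix.gauge_conj {ρ : Op N T} (hρ : IsDensityMatrix ρ) (U : Circuit N T) :
    IsDensityMatrix ((gauge U)ᴴ * ρ * gauge U) := by
  refine ⟨hρ.1.conjTranspose_mul_mul_same _, ?_⟩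
  rw [Matrix.trace_mul_comm, ← Matrix.mul_assoc, gauge_mul_conjTranspose_self, Matrix.one_mul,
    hρ.2]

/-- The squared dimension 4^N (T+1)² multiplies the entrywise prefactor 3·2^N (T+1)²(T+2). -/
lemma traceNorm_pow_sub_le (hF : IsClockWalk F)
    (h𝒦 : ∀ Y, 𝒦 (gauge U * Y * (gauge U)ᴴ) = gauge U * F Y * (gauge U)ᴴ)
    {ρ : Op N T} (hρ : IsDensityMatrix ρ) (m : ℕ) :
    traceNorm ((𝒦 ^ m) ρ - replaceBy (rhoInf U) ρ)
      ≤ 3 * 8 ^ N * ((T : ℝ) + 2) ^ 5 * walkRate T ^ m := by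
  have hr := pow_nonneg (walkRate_nonneg T) m
  rw [eq_gauge_conj U ρ, pow_sub_replaceBy_eq h𝒦]
  refine (traceNorm_unitary_conj_le (gauge_conjTranspose_mul_self U) (by positivity)
    (hF.norm_sub_smul_rhoInf_le (hρ.gauge_conj U).norm_apply_le_one m)).trans ?_
  have h8 : (8 : ℝ) ^ N = (2 ^ N) ^ 3 := by
    rw [← pow_mul, mul_comm, pow_mul]
    norm_num
  calc _ = 3 * 8 ^ N * (((T : ℝ) + 1) ^ 4 * (T + 2)) * walkRate T ^ m := by
        rw [h8]
        simp only [Fintype.card_prod, Fintype.card_fun, Fintype.card_fin]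
        push_cast
        ring
    _ ≤ 3 * 8 ^ N * (((T : ℝ) + 2) ^ 4 * (T + 2)) * walkRate T ^ m := by 
        gcongr
        norm_num
    _ = _ := by ring

lemma walkRate_pow_le (T m : ℕ) :
    walkRate T ^ m ≤ Real.exp (-(m / (((T : ℝ) + 1) * (T + 2)))) := by
  have h : walkRate T ≤ Real.exp (-(1 / (((T : ℝ) + 1) * (T + 2)))) := by
    have := Real.add_one_le_exp (-(1 / (((T : ℝ) + 1) * (T + 2))))
    unfold walkRate
    linarith
  calc _ ≤ Real.exp (-(1 / (((T : ℝ) + 1) * (T + 2)))) ^ m :=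
        pow_le_pow_left₀ (walkRate_nonneg T) h m
    _ = _ := by
        rw [← Real.exp_nat_mul]
        congr 1
        ring

/-- As T ≥ 2, log T ≥ 1/2 and T + 2 ≤ T². With L = log T, the terms free of ε are at most 2 + 3N +
10L ≤ (4 + 6 + 10) N L. They acquire the factor log(1/ε) at the price of 1/log(1/ε₀), which is why ε
must stay below ε₀ < 1. The remaining log(1/ε) is at most 2 N L log(1/ε). -/
lemma log_prefactor_le {ε₀ ε : ℝ} (hε₀ : 0 < ε₀) (hε₀' : ε₀ < 1) (hN : 1 ≤ N) (hT : 2 ≤ T)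
    (hε : 0 < ε) (hεε₀ : ε ≤ ε₀) :
    Real.log (3 * 8 ^ N * ((T : ℝ) + 2) ^ 5 / ε)
      ≤ (20 / Real.log (1 / ε₀) + 2) * (N * Real.log T * Real.log (1 / ε)) := by
  have hN' : (1 : ℝ) ≤ N := by exact_mod_cast hN
  have hT' : (2 : ℝ) ≤ T := by exact_mod_cast hT
  have hl0 : 0 < Real.log (1 / ε₀) := Real.log_pos ((one_lt_div hε₀).2 hε₀')
  have hl : Real.log (1 / ε₀) ≤ Real.log (1 / ε) :=
    Real.log_le_log (by positivity) (one_div_le_one_div_of_le hε hεε₀)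
  have hL : 1 / 2 ≤ Real.log T :=
    (by linarith [Real.log_two_gt_d9] : 1 / 2 ≤ Real.log 2).trans
      (Real.log_le_log (by norm_num) hT')
  have h3 : Real.log 3 ≤ 2 := by
    have := Real.log_le_sub_one_of_pos (show (0 : ℝ) < 3 by norm_num)
    linarith
  have h8 : Real.log 8 ≤ 3 := by
    rw [show (8 : ℝ) = 2 ^ 3 by norm_num, Real.log_pow]
    push_cast
    linarith [Real.log_two_lt_d9]
  have hT2 : Real.log (T + 2) ≤ 2 * Real.log T := by
    rw [← Real.log_rpow (by linarith)]
    apply Real.log_le_log (by linarith)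
    rw [Real.rpow_two]
    nlinarith
  have e : Real.log (3 * 8 ^ N * ((T : ℝ) + 2) ^ 5 / ε)
      = Real.log 3 + N * Real.log 8 + 5 * Real.log (T + 2) + Real.log (1 / ε) := by
    rw [div_eq_mul_one_div, Real.log_mul (by positivity) (by positivity),
      Real.log_mul (by positivity) (by positivity), Real.log_mul (by positivity) (by positivity),
      Real.log_pow, Real.log_pow]
    norm_num
  set l₀ := Real.log (1 / ε₀)
  set l := Real.log (1 / ε)
  set L := Real.log T
  have hl' : 0 < l := hl0.trans_le hl
  have hNL : 1 / 2 * N ≤ N * L := by nlinarith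
  have hq : 1 ≤ l / l₀ := (one_le_div hl0).2 hl
  have hNLq : N * L ≤ N * L * (l / l₀) := le_mul_of_one_le_right (by linarith) hq
  have hLq : L ≤ N * L := le_mul_of_one_le_left (by linarith) hN'
  have hll : l ≤ 2 * (N * L * l) := by nlinarith
  have e2 : (20 / l₀ + 2) * (N * L * l) = 20 * (N * L * (l / l₀)) + 2 * (N * L * l) := by ring
  rw [e, e2]
  nlinarith

/-- A channel gauge-equivalent to a clock walk has convergence time
`O(N T² log T log(1/ε))`. -/
lemma exists_isConvergenceTime_le {ε₀ ε : ℝ} (hε₀ : 0 < ε₀) (hε₀' : ε₀ < 1) (hN : 1 ≤ N)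
    (hT : 2 ≤ T) (hε : 0 < ε) (hεε₀ : ε ≤ ε₀) (hF : IsClockWalk F)
    (h𝒦 : ∀ Y, 𝒦 (gauge U * Y * (gauge U)ᴴ) = gauge U * F Y * (gauge U)ᴴ) :
    ∃ m : ℕ, IsConvergenceTime 𝒦 (replaceBy (rhoInf U)) ε m ∧
      (m : ℝ) ≤ 6 * (20 / Real.log (1 / ε₀) + 2) *
        (N * (T : ℝ) ^ 2 * Real.log T * Real.log (1 / ε)) := by
  set P : ℝ := 3 * 8 ^ N * ((T : ℝ) + 2) ^ 5 with hP
  set A : ℝ := ((T : ℝ) + 1) * (T + 2) with hA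
  have hT' : (2 : ℝ) ≤ T := by exact_mod_cast hT
  have hP0 : 0 < P := by positivity
  have hA0 : 0 < A := by positivity
  have hlog := log_prefactor_le hε₀ hε₀' hN hT hε hεε₀
  rw [← hP] at hlog
  have hPε : 3 ≤ P / ε := by
    rw [le_div_iff₀ hε]
    have h1 : (1 : ℝ) ≤ 8 ^ N := one_le_pow₀ (by norm_num)
    have h2 : (1 : ℝ) ≤ ((T : ℝ) + 2) ^ 5 := one_le_pow₀ (by linarith)
    have h3 : (1 : ℝ) ≤ 8 ^ N * ((T : ℝ) + 2) ^ 5 := one_le_mul_of_one_le_of_one_le h1 h2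
    rw [hP, mul_assoc]
    nlinarith
  have hS : 1 ≤ Real.log (P / ε) := by
    rw [Real.le_log_iff_exp_le (by positivity)]
    linarith [Real.exp_one_lt_d9]
  -- This bound allows the rounding up below to cost only a factor 2.
  have hAS : 1 ≤ A * Real.log (P / ε) := by
    have : 1 ≤ A := by nlinarith
    exact one_le_mul_of_one_le_of_one_le this hS
  -- The number of steps is chosen so that P exp(-m/A) ≤ ε.
  have hmem : ⌈A * Real.log (P / ε)⌉₊ ∈ {k : ℕ | 0 < k ∧
      ∀ ρ, IsDensityMatrix ρ → traceNorm ((𝒦 ^ k) ρ - replaceBy (rhoInf U) ρ) ≤ ε} := by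
    refine ⟨Nat.ceil_pos.2 (by linarith), fun ρ hρ => ?_⟩
    refine (traceNorm_pow_sub_le hF h𝒦 hρ _).trans ?_
    rw [← hP]
    have h1 := walkRate_pow_le T ⌈A * Real.log (P / ε)⌉₊
    have h2 : Real.log (P / ε) ≤ (⌈A * Real.log (P / ε)⌉₊ : ℝ) / A := by
      rw [le_div_iff₀ hA0, mul_comm]
      exact Nat.le_ceil _
    calc _ ≤ P * Real.exp (-Real.log (P / ε)) :=
          mul_le_mul_of_nonneg_left
            (h1.trans (Real.exp_le_exp.2 (neg_le_neg h2))) hP0.le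
      _ = ε := by
          rw [Real.exp_neg, Real.exp_log (by positivity)]
          field_simp
  refine ⟨_, ⟨Nat.sInf_mem ⟨_, hmem⟩, fun k hk => Nat.sInf_le hk⟩, ?_⟩
  calc _ ≤ (⌈A * Real.log (P / ε)⌉₊ : ℝ) := Nat.cast_le.2 (Nat.sInf_le hmem)
    _ ≤ 2 * (A * Real.log (P / ε)) := by
        linarith [Nat.ceil_lt_add_one (zero_le_one.trans hAS)]
    _ ≤ 2 * (3 * (T : ℝ) ^ 2 * Real.log (P / ε)) := by
        -- Equivalent to (2T + 1)(T - 2) ≥ 0.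
        have : A ≤ 3 * (T : ℝ) ^ 2 := by nlinarith
        gcongr
    _ ≤ 2 * (3 * (T : ℝ) ^ 2 *
        ((20 / Real.log (1 / ε₀) + 2) * (N * Real.log T * Real.log (1 / ε)))) := by gcongr
    _ = _ := by ring

end Convergence

end DQC

theorem mainTheorem8 :
    (∀ N T : ℕ, 1 ≤ N → 1 ≤ T → ∀ U : DQC.Circuit N T,
      (DQC.IsUniqueStationaryState (DQC.channelD U) (DQC.rhoInf U) ∧
        DQC.IsLimitMap (DQC.channelD U) (DQC.replaceBy (DQC.rhoInf U))) ∧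
      (DQC.IsUniqueStationaryState (DQC.channelC U) (DQC.rhoInf U) ∧
        DQC.IsLimitMap (DQC.channelC U) (DQC.replaceBy (DQC.rhoInf U)))) ∧
    (∀ ε₀ : ℝ, 0 < ε₀ → ε₀ < 1 → ∃ K : ℝ, 0 < K ∧
      ∀ N T : ℕ, 1 ≤ N → 2 ≤ T → ∀ U : DQC.Circuit N T, ∀ ε : ℝ, 0 < ε → ε ≤ ε₀ →
        (∃ m : ℕ,
          DQC.IsConvergenceTime (DQC.channelD U) (DQC.replaceBy (DQC.rhoInf U)) ε m ∧
          (m : ℝ) ≤ K * (N * (T : ℝ) ^ 2 * Real.log T * Real.log (1 / ε))) ∧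
        (∃ m : ℕ,
          DQC.IsConvergenceTime (DQC.channelC U) (DQC.replaceBy (DQC.rhoInf U)) ε m ∧
          (m : ℝ) ≤ K * (N * (T : ℝ) ^ 2 * Real.log T * Real.log (1 / ε)))) := by
  refine ⟨fun N T _ _ U => ⟨?_, ?_⟩, fun ε₀ hε₀ hε₀' => ?_⟩
  · have h := DQC.isLimitMap_of_isClockWalk DQC.isClockWalk_channelD_one (DQC.channelD_gauge_conj U)
    exact ⟨h.isUniqueStationaryState (DQC.isDensityMatrix_rhoInf U), h⟩
  · have h := DQC.isLimitMap_of_isClockWalk DQC.isClockWalk_channelC_one (DQC.channelC_gauge_conj U)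
    exact ⟨h.isUniqueStationaryState (DQC.isDensityMatrix_rhoInf U), h⟩
  · have hl : 0 < Real.log (1 / ε₀) := Real.log_pos ((one_lt_div hε₀).2 hε₀')
    refine ⟨6 * (20 / Real.log (1 / ε₀) + 2), by positivity, fun N T hN hT U ε hε hεε₀ => ⟨?_, ?_⟩⟩
    · exact DQC.exists_isConvergenceTime_le hε₀ hε₀' hN hT hε hεε₀ DQC.isClockWalk_channelD_one
        (DQC.channelD_gauge_conj U)
    · exact DQC.exists_isConvergenceTime_le hε₀ hε₀' hN hT hε hεε₀ DQC.isClockWalk_channelC_one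
        (DQC.channelC_gauge_conj U)
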